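/- **Theorem (Asymptotic distribution of the estimator).** Let $\mathcal C$ be the set of univariate cumulative distribution functions (CDFs), and let $d:\mathcal C\times\mathcal C\to\mathbb R$ be a distance on $\mathcal C$: $d(f,g)\ge 0$; $d(f,g)=d(g,f)$; $d(f,g)\le d(f,h)+d(h,g)$; and $d(f,g)=0$ if and only if $f(t)=g(t)$ for all $t$. Suppose that, for every $g\in\mathcal C$, the function $d(\cdot,g)$ is continuous with respect to the sup-norm, and that there is a constant $M$ with $d(f,g)\le M$ for all $f,g\in\mathcal C$. Let $X$ and $Y$ be random vectors in $\mathbb R^n$ and let $q$ be a random element of the unit sphere of $\mathbb R^n$, each on its own probability space. For $u$ in the unit sphere write $F_X^u(t)=\mathbb P(u^\top X\le t)$ and $F_Y^u(t)=\mathbb P(u^\top Y\le t)$, and put $$\Delta(X,Y)=\mathbb E_q\big[d(F_X^q,F_Y^q)\big],\qquad \sigma^2=\mathrm{var}_q\big[d(F_X^q,F_Y^q)\big].$$ Let $(q_i)_{i\ge1}$ be i.i.d. copies of $q$ and $(X_{i,j})_{i,j\ge1}$ i.i.d. copies of $X$, all on one probability space, with the family $(q_i)_i$ independent of the family $(X_{i,j})_{i,j}$.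 For $H,N\ge1$ let $$\hat F_X^{q_i,N}(t)=\frac1N\sum_{j=1}^N\mathbf 1\big(q_i^\top X_{i,j}\le t\big),\qquad \hat\Delta_{H,N}=\frac1H\sum_{i=1}^H d\big(\hat F_X^{q_i,N},F_Y^{q_i}\big).$$ Assume that the functions $u\mapsto d(F_X^u,F_Y^u)$ and, for each $N$, $(u,x_1,\dots,x_N)\mapsto d\big(\tfrac1N\sum_{j}\mathbf 1(u^\top x_j\le\cdot\,),F_Y^u\big)$ are measurable (up to null sets) for the law of $q$ and for the joint law of $(q,X_1,\dots,X_N)$ respectively, where $X_1,\dots,X_N$ are i.i.d. copies of $X$ independent of $q$. 1. For every sequence $(N_H)_{H\ge1}$ of positive integers with $N_H\to\infty$ as $H\to\infty$, $$\sqrt H\big(\hat\Delta_{H,N_H}-\mathbb E[\hat\Delta_{H,N_H}]\big)\xrightarrow{D}\mathcal N(0,\sigma^2)\qquad(H\to\infty),$$ and $$\sqrt H\big(\hat\Delta_{H,N_H}-\Delta(X,Y)\big)\xrightarrow{D}\mathcal N(0,\sigma^2)\qquad(H\to\infty)$$ holds if and only if the scaled bias vanishes, i.e. $\sqrt H\big(\mathbb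 E[\hat\Delta_{H,N_H}]-\Delta(X,Y)\big)\to0$. 2. The latter convergence holds whenever $N_H$ grows fast enough: there is a sequence $(N^0_H)_{H\ge1}$ of positive integers such that, for every sequence $(N_H)$ of positive integers with $N_H\ge N_H^0$ for all sufficiently large $H$, $$\sqrt H\big(\hat\Delta_{H,N_H}-\Delta(X,Y)\big)\xrightarrow{D}\mathcal N(0,\sigma^2)\qquad(H\to\infty).$$ (When $\sigma^2=0$, $\mathcal N(0,0)$ denotes the point mass at $0$.) -/

import Mathlib

open MeasureTheory ProbabilityTheory Filter
open scoped Topology RealInnerProductSpace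

noncomputable section

namespace SlicedCDF

/-- Euclidean space of dimension `n`. -/
abbrev E (n : ℕ) : Type := EuclideanSpace ℝ (Fin n)

/-- The unit sphere in Euclidean space of dimension `n`. -/
abbrev Sph (n : ℕ) : Type := Metric.sphere (0 : E n) 1

/-- A univariate cumulative distribution function. -/
@[ext]
structure CDF where
  toFun : ℝ → ℝ
  mono : Monotone toFun
  rightCont : ∀ t, ContinuousWithinAt toFun (Set.Ici t) t
  atBot : Tendsto toFun atBot (𝓝 0)
  atTop : Tendsto toFun atTop (𝓝 1)

instance : CoeFun CDF (fun _ => ℝ → ℝ) := ⟨CDF.toFun⟩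

/-- The axioms of a (finite-valued) distance on the set of univariate CDFs. -/
structure IsDistance (d : CDF → CDF → ℝ) : Prop where
  nonneg : ∀ f g, 0 ≤ d f g
  symm : ∀ f g, d f g = d g f
  triangle : ∀ f g h, d f g ≤ d f h + d h g
  eq_zero_iff : ∀ f g, d f g = 0 ↔ ∀ t, f t = g t

/-- The sup-norm of the difference of two CDFs (a supremum of numbers in `[0, 1]`). -/
def supDist (f g : CDF) : ℝ := ⨆ t : ℝ, |f t - g t|

/-- Continuity in the first argument with respect to the sup-norm, for every fixed second
argument. -/
def SupContinuousFst (d : CDF → CDF → ℝ) : Prop :=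
  ∀ g f : CDF, ∀ ε > 0, ∃ δ > 0, ∀ f' : CDF, supDist f' f < δ → |d f' g - d f g| < ε

/-- The CDF of the one-dimensional linear projection `⟪u, X⟫` of the random vector `X`. -/
def projCDF {n : ℕ} {Ω : Type*} [MeasurableSpace Ω] (P : Measure Ω) (X : Ω → E n) (u : E n) :
    CDF where
  toFun := fun t => cdf (P.map (fun ω => ⟪u, X ω⟫)) t
  mono := monotone_cdf _
  rightCont := fun t => (cdf (P.map (fun ω => ⟪u, X ω⟫))).right_continuous t
  atBot := tendsto_cdf_atBot _
  atTop := tendsto_cdf_atTop _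

/-- For a random vector `X`, the function `projCDF P X u` is `t ↦ P(⟪u, X⟫ ≤ t)`. -/
theorem projCDF_apply {n : ℕ} {Ω : Type*} [MeasurableSpace Ω] (P : Measure Ω)
    [IsProbabilityMeasure P] (X : Ω → E n) (hX : Measurable X) (u : E n) (t : ℝ) :
    projCDF P X u t = P.real {ω | ⟪u, X ω⟫ ≤ t} := by
  have hm : Measurable (fun ω => ⟪u, X ω⟫) := by fun_prop
  have : IsProbabilityMeasure (P.map (fun ω => ⟪u, X ω⟫)) :=
    Measure.isProbabilityMeasure_map hm.aemeasurable
  change cdf (P.map (fun ω => ⟪u, X ω⟫)) t = _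
  rw [cdf_eq_real, map_measureReal_apply hm measurableSet_Iic]
  rfl

/-- The function `t ↦ (1 / N) * #{j | x j ≤ t}`. -/
def empFun {N : ℕ+} (x : Fin N → ℝ) (t : ℝ) : ℝ :=
  (1 / ((N : ℕ) : ℝ)) * ∑ j, (Set.Ici (x j)).indicator (fun _ => (1 : ℝ)) t

/-- The empirical CDF of the real sample `x 0, …, x (N - 1)`, where `N` is positive. -/
def empCDF {N : ℕ+} (x : Fin N → ℝ) : CDF where
  toFun := empFun x
  mono := by
    intro s t hst
    unfold empFun
    refine mul_le_mul_of_nonneg_left (Finset.sum_le_sum fun j _ => ?_) (by positivity)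
    by_cases h : x j ≤ s
    · simp [Set.indicator, h, h.trans hst]
    · simp only [Set.indicator, Set.mem_Ici, h, if_false]
      split_ifs <;> norm_num
  rightCont := by
    intro t
    unfold empFun
    refine ContinuousWithinAt.mul continuousWithinAt_const ?_
    refine tendsto_finsetSum _ fun j _ => ?_
    refine tendsto_nhds_of_eventually_eq ?_
    by_cases h : x j ≤ t
    · filter_upwards [self_mem_nhdsWithin] with s hs
      have hs' : x j ≤ s := h.trans hs
      simp [Set.indicator, h, hs']
    · have : ∀ᶠ s in 𝓝[Set.Ici t] t, s < x j :=
        mem_nhdsWithin_of_mem_nhds (Iio_mem_nhds (not_le.mp h))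
      filter_upwards [this] with s hs
      simp [Set.indicator, h, not_le.mpr hs]
  atBot := by
    have hz : Tendsto (fun t => (1 / ((N : ℕ) : ℝ)) *
        ∑ j, (Set.Ici (x j)).indicator (fun _ => (1 : ℝ)) t) atBot
        (𝓝 ((1 / ((N : ℕ) : ℝ)) * ∑ _j : Fin N, (0 : ℝ))) := by
      refine Tendsto.mul tendsto_const_nhds (tendsto_finsetSum _ fun j _ => ?_)
      refine tendsto_nhds_of_eventually_eq ?_
      filter_upwards [eventually_lt_atBot (x j)] with s hs
      simp [Set.indicator, not_le.mpr hs]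
    have h0 : (1 / ((N : ℕ) : ℝ)) * ∑ _j : Fin N, (0 : ℝ) = 0 := by simp
    rw [h0] at hz
    exact hz
  atTop := by
    have hz : Tendsto (fun t => (1 / ((N : ℕ) : ℝ)) *
        ∑ j, (Set.Ici (x j)).indicator (fun _ => (1 : ℝ)) t) atTop
        (𝓝 ((1 / ((N : ℕ) : ℝ)) * ∑ _j : Fin N, (1 : ℝ))) := by
      refine Tendsto.mul tendsto_const_nhds (tendsto_finsetSum _ fun j _ => ?_)
      refine tendsto_nhds_of_eventually_eq ?_
      filter_upwards [eventually_ge_atTop (x j)] with s hs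
      simp [Set.indicator, hs]
    have hN : ((N : ℕ) : ℝ) ≠ 0 := by exact_mod_cast N.pos.ne'
    have h1 : (1 / ((N : ℕ) : ℝ)) * ∑ _j : Fin N, (1 : ℝ) = 1 := by
      simp [hN]
    rw [h1] at hz
    exact hz

section Quantities

variable {n : ℕ} {ΩX ΩY Ωq Ω : Type*} [MeasurableSpace ΩX] [MeasurableSpace ΩY]
  [MeasurableSpace Ωq]

/-- `Δ(X, Y)`: the expectation over `q` of `d (F_X^q, F_Y^q)`. -/
def slicedDist (d : CDF → CDF → ℝ) (PX : Measure ΩX) (PY : Measure ΩY) (Pq : Measure Ωq)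
    (X : ΩX → E n) (Y : ΩY → E n) (q : Ωq → Sph n) : ℝ :=
  ∫ w, d (projCDF PX X (q w)) (projCDF PY Y (q w)) ∂Pq

/-- The variance over `q` of `d (F_X^q, F_Y^q)`. -/
def slicedVar (d : CDF → CDF → ℝ) (PX : Measure ΩX) (PY : Measure ΩY) (Pq : Measure Ωq)
    (X : ΩX → E n) (Y : ΩY → E n) (q : Ωq → Sph n) : ℝ :=
  Var[fun w => d (projCDF PX X (q w)) (projCDF PY Y (q w)); Pq]

/-- The distance between the empirical CDF of the projections on `u` of a sample
`x 0, …, x (N - 1)` and the CDF of the projection of `Y` on `u`. -/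
def empDist (d : CDF → CDF → ℝ) (PY : Measure ΩY) (Y : ΩY → E n) {N : ℕ+} (u : Sph n)
    (x : Fin N → E n) : ℝ :=
  d (empCDF fun j => ⟪(u : E n), x j⟫) (projCDF PY Y u)

/-- The estimator built from `H` directions `qs i` and, for each of them, `N` samples `Xs i j`. -/
def estimator (d : CDF → CDF → ℝ) (PY : Measure ΩY) (Y : ΩY → E n)
    (qs : ℕ → Ω → Sph n) (Xs : ℕ → ℕ → Ω → E n) (H : ℕ) (N : ℕ+) (ω : Ω) : ℝ :=
  (1 / (H : ℝ)) * ∑ i ∈ Finset.range H,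
    empDist d PY Y (qs i ω) (fun j : Fin N => Xs i j ω)

end Quantities

end SlicedCDF

end

/-! ### Quantiles and the deterministic half of Glivenko–Cantelli -/

namespace SlicedCDF

/-! The summands of the estimator are close to the i.i.d. bounded variables `D (qs i)`, where `D u`
is the distance between the true projected CDFs, so the classical central limit theorem for the
latter should transfer.

For a fixed direction, Glivenko–Cantelli (`ae_tendsto_supDist_empCDF`) and sup-norm continuity of
`d` send the error `empError` to `0` almost surely. Fubini and dominated convergence, with the bound
`M`, then give convergence of its first and second moments (`tendsto_integral_empError_pow`).

The second moment handles fluctuations: by Chebyshev, the centred error sum divided by `√H` has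
variance at most the mean square of a single error, so no rate for `N_H` is needed
(`tendstoInDistribution_of_approx`). The first moment is the bias. Centring at `Δ` instead of the
mean adds the constant `√H * bias`. Slutsky shows that a vanishing shift is harmless; conversely,
Gaussian characteristic functions have no zeros, so dividing by them forces the shift to vanish.
Finally, since the bias tends to `0` in `N`, a sufficiently large `N_H` beats the factor `√H`. -/

theorem CDF.nonneg (F : CDF) (t : ℝ) : 0 ≤ F t :=
  F.mono.le_of_tendsto F.atBot t

theorem CDF.le_one (F : CDF) (t : ℝ) : F t ≤ 1 :=
  F.mono.ge_of_tendsto F.atTop t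

/-- A CDF has a quantile at every level `c` strictly between `0` and `1`. -/
theorem CDF.exists_quantile (F : CDF) {c : ℝ} (h0 : 0 < c) (h1 : c < 1) :
    ∃ s, ∀ t, c ≤ F t ↔ s ≤ t := by
  have hne : {t | c ≤ F t}.Nonempty := by
    obtain ⟨t, ht⟩ := (F.atTop.eventually (lt_mem_nhds h1)).exists
    exact ⟨t, ht.le⟩
  have hbdd : BddBelow {t | c ≤ F t} := by
    obtain ⟨t, ht⟩ := (F.atBot.eventually (gt_mem_nhds h0)).exists
    refine ⟨t, fun r hr => ?_⟩
    by_contra! h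
    exact absurd (hr.trans (F.mono h.le)) (not_le.2 ht)
  -- Right continuity makes the infimum of the superlevel set a point of it.
  have hs : c ≤ F (sInf {t | c ≤ F t}) := by
    have hlim : Tendsto F (𝓝[>] sInf {t | c ≤ F t}) (𝓝 (F (sInf {t | c ≤ F t}))) :=
      (F.rightCont _).mono_left (nhdsWithin_mono _ Set.Ioi_subset_Ici_self)
    refine ge_of_tendsto hlim ?_
    filter_upwards [self_mem_nhdsWithin] with t ht
    obtain ⟨r, hr, hrt⟩ := exists_lt_of_csInf_lt hne ht
    exact le_trans hr (F.mono hrt.le)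
  exact ⟨_, fun t => ⟨fun h => csInf_le hbdd h, fun h => hs.trans (F.mono h)⟩⟩

theorem supDist_le {f g : CDF} {ε : ℝ} (h : ∀ t, |f t - g t| ≤ ε) : supDist f g ≤ ε :=
  ciSup_le h

theorem supDist_nonneg (f g : CDF) : 0 ≤ supDist f g :=
  Real.iSup_nonneg fun _ => abs_nonneg _

/-- The proportion of the points `x 0, …, x (N - 1)` that lie in `A`. -/
noncomputable def proportion (x : ℕ → ℝ) (A : Set ℝ) (N : ℕ) : ℝ :=
  (∑ j ∈ Finset.range N, A.indicator (fun _ => (1 : ℝ)) (x j)) / N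

theorem proportion_mono (x : ℕ → ℝ) {A B : Set ℝ} (h : A ⊆ B) (N : ℕ) :
    proportion x A N ≤ proportion x B N := by
  unfold proportion
  gcongr

theorem empCDF_eq_proportion (x : ℕ → ℝ) (N : ℕ+) (t : ℝ) :
    empCDF (N := N) (fun j => x j) t = proportion x (Set.Iic t) N := by
  change (1 / ((N : ℕ) : ℝ)) * ∑ j : Fin N, (Set.Ici (x j)).indicator (fun _ => (1 : ℝ)) t = _
  rw [proportion, ← Fin.sum_univ_eq_sum_range
    (fun j => (Set.Iic t).indicator (fun _ => (1 : ℝ)) (x j)), one_div, div_eq_inv_mul]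
  rfl

/-- Pointwise convergence of the empirical CDFs, and of their left limits, at the quantiles of
rational level implies uniform convergence. -/
theorem tendsto_supDist_empCDF (x : ℕ → ℝ) (F : CDF) (s p : ℕ → ℕ → ℝ)
    (hs : ∀ m k : ℕ, 0 < k → k < m → ∀ t, (k : ℝ) / m ≤ F t ↔ s m k ≤ t)
    (hle : ∀ m k, Tendsto (proportion x (Set.Iic (s m k))) atTop (𝓝 (F (s m k))))
    (hlt : ∀ m k, Tendsto (proportion x (Set.Iio (s m k))) atTop (𝓝 (p m k)))
    (hp : ∀ m k : ℕ, 0 < k → k < m → p m k ≤ (k : ℝ) / m) :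
    Tendsto (fun N : ℕ+ => supDist (empCDF (N := N) (fun j => x j)) F) atTop (𝓝 0) := by
  rw [Metric.tendsto_atTop']
  intro ε hε
  -- The levels `k / (m + 1)` form a grid of mesh below `ε / 3`. The error at a grid quantile costs
  -- another `ε / 3`, and the last third keeps the final inequality strict.
  obtain ⟨m, hm⟩ := exists_nat_one_div_lt (show 0 < ε / 3 by positivity)
  have hev : ∀ᶠ N in atTop, ∀ k ∈ Finset.range (m + 1),
      |proportion x (Set.Iic (s (m + 1) k)) N - F (s (m + 1) k)| < ε / 3 ∧
      |proportion x (Set.Iio (s (m + 1) k)) N - p (m + 1) k| < ε / 3 := by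
    rw [Finset.eventually_all]
    intro k _
    exact ((hle (m + 1) k).eventually (Metric.ball_mem_nhds _ (by positivity))).and
      ((hlt (m + 1) k).eventually (Metric.ball_mem_nhds _ (by positivity)))
  obtain ⟨N₀, hN₀⟩ := eventually_atTop.1 hev
  refine ⟨N₀.succPNat, fun N hN => ?_⟩
  have hN' : N₀ ≤ (N : ℕ) := by
    have : (N₀.succPNat : ℕ) < N := hN
    rw [Nat.succPNat_coe] at this
    omega
  have hb := hN₀ N hN'
  rw [Real.dist_eq, sub_zero, abs_of_nonneg (supDist_nonneg _ _)]
  refine lt_of_le_of_lt (b := ε / 3 + ε / 3) (supDist_le fun t => ?_) (by linarith)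
  have hm0 : (0 : ℝ) < (m : ℝ) + 1 := by positivity
  -- `F t` lies in the grid cell from `k / (m + 1)` to `(k + 1) / (m + 1)`.
  set k := ⌊((m : ℝ) + 1) * F t⌋₊ with hk
  have hk1 : (k : ℝ) ≤ ((m : ℝ) + 1) * F t :=
    Nat.floor_le (mul_nonneg hm0.le (F.nonneg t))
  have hk2 : ((m : ℝ) + 1) * F t < k + 1 := Nat.lt_floor_add_one _
  have hdiv1 : (k : ℝ) / (m + 1) ≤ F t := by rw [div_le_iff₀ hm0]; linarith
  have hdiv2 : F t < ((k : ℝ) + 1) / (m + 1) := by rw [lt_div_iff₀ hm0]; linarith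
  have hstep : ((k : ℝ) + 1) / (m + 1) = (k : ℝ) / (m + 1) + 1 / (m + 1) := add_div _ _ _
  have hnonneg := (empCDF (N := N) (fun j => x j)).nonneg t
  have hle_one := (empCDF (N := N) (fun j => x j)).le_one t
  rw [abs_le]
  constructor
  -- Lower bound: compare with the quantile of level `k / (m + 1)`, which is at most `t`. At level
  -- `0` there is none, but `F t` is then itself below the mesh.
  · by_cases hk0 : k = 0
    · rw [hk0] at hdiv2 hstep
      simp only [Nat.cast_zero, zero_div, zero_add] at hdiv2 hstep
      linarith
    by_cases hkm : k < m + 1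
    · have hst : s (m + 1) k ≤ t :=
        (hs (m + 1) k (by omega) hkm t).1 (by push_cast; exact hdiv1)
      have hF : (k : ℝ) / (m + 1) ≤ F (s (m + 1) k) := by
        simpa using (hs (m + 1) k (by omega) hkm _).2 le_rfl
      have := (abs_lt.1 (hb k (Finset.mem_range.2 hkm)).1).1
      have hmono := proportion_mono x (Set.Iic_subset_Iic.2 hst) N
      rw [empCDF_eq_proportion]
      linarith
    -- Here `F t = 1`, a level that need not have a quantile. The level `m / (m + 1)`, one mesh
    -- lower, replaces it; for `m = 0` the mesh is `1` and `ε > 3`.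
    · by_cases hm' : m = 0
      · subst hm'
        have := F.le_one t
        norm_num at hm
        linarith
      have hst : s (m + 1) m ≤ t := by
        refine (hs (m + 1) m (by omega) (by omega) t).1 ?_
        push_cast
        refine le_trans ?_ hdiv1
        gcongr
        omega
      have hF : (m : ℝ) / (m + 1) ≤ F (s (m + 1) m) := by
        simpa using (hs (m + 1) m (by omega) (by omega) _).2 le_rfl
      have := (abs_lt.1 (hb m (Finset.mem_range.2 (by omega))).1).1
      have hmono := proportion_mono x (Set.Iic_subset_Iic.2 hst) N
      have hone : (m : ℝ) / (m + 1) = 1 - 1 / (m + 1) := by field_simp; ring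
      have := F.le_one t
      rw [empCDF_eq_proportion]
      linarith
  -- Upper bound: `t` lies strictly left of the next quantile, so the open half-line is used. `F`
  -- may jump at the quantile, but its left limit stays below the level.
  · by_cases hkm : k + 1 < m + 1
    · have hts : t < s (m + 1) (k + 1) := by
        by_contra! h
        have := (hs (m + 1) (k + 1) (by omega) hkm t).2 h
        push_cast at this
        linarith
      have := (abs_lt.1 (hb (k + 1) (Finset.mem_range.2 hkm)).2).2
      have hp' := hp (m + 1) (k + 1) (by omega) hkm
      push_cast at hp'
      have hmono := proportion_mono x (Set.Iic_subset_Iio.2 hts) N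
      rw [empCDF_eq_proportion]
      linarith
    · have : (1 : ℝ) ≤ ((k : ℝ) + 1) / (m + 1) := by
        rw [le_div_iff₀ hm0]
        have : ((m + 1 : ℕ) : ℝ) ≤ ((k + 1 : ℕ) : ℝ) := by exact_mod_cast not_lt.1 hkm
        push_cast at this
        linarith
      linarith

/-! ### Glivenko–Cantelli for random samples, and regrouping of independent pairs -/

section Empirical

variable {Ω : Type*} [MeasurableSpace Ω] {Q : Measure Ω} [IsProbabilityMeasure Q]

theorem ae_tendsto_proportion {Y : ℕ → Ω → ℝ} (hY : ∀ j, Measurable (Y j))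
    (hindep : Pairwise fun i j => IndepFun (Y i) (Y j) Q)
    (hident : ∀ j, IdentDistrib (Y j) (Y 0) Q Q) {A : Set ℝ} (hA : MeasurableSet A) :
    ∀ᵐ ω ∂Q, Tendsto (proportion (fun j => Y j ω) A) atTop (𝓝 (Q.real (Y 0 ⁻¹' A))) := by
  have hm : Measurable (A.indicator fun _ => (1 : ℝ)) := measurable_const.indicator hA
  have h := strong_law_ae_real (μ := Q) (fun j ω => A.indicator (fun _ => (1 : ℝ)) (Y j ω))
    (Integrable.of_bound (C := 1) (hm.comp (hY 0)).aestronglyMeasurable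
      (ae_of_all _ fun ω => (norm_indicator_le_norm_self _ _).trans (by simp)))
    (fun i j hij => (hindep hij).comp hm hm) (fun j => (hident j).comp hm)
  have hint : ∫ ω, A.indicator (fun _ => (1 : ℝ)) (Y 0 ω) ∂Q = Q.real (Y 0 ⁻¹' A) := by
    rw [← integral_indicator_one (hY 0 hA)]
    rfl
  rw [hint] at h
  exact h

/-- Continuity from below along a sequence increasing strictly to `s`. It bounds left limits at
quantiles. -/
theorem measureReal_lt_le_of_forall {Y : Ω → ℝ} {s c : ℝ}
    (h : ∀ t < s, Q.real (Y ⁻¹' Set.Iic t) ≤ c) : Q.real (Y ⁻¹' Set.Iio s) ≤ c := by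
  obtain ⟨u, hu, hus, hlim⟩ := exists_seq_strictMono_tendsto s
  have hU : Y ⁻¹' Set.Iio s = ⋃ n, Y ⁻¹' Set.Iic (u n) := by
    rw [← Set.preimage_iUnion, iUnion_Iic_eq_Iio_of_lt_of_tendsto hus hlim]
  rw [hU]
  have ht : Tendsto (fun n => Q.real (Y ⁻¹' Set.Iic (u n))) atTop
      (𝓝 (Q.real (⋃ n, Y ⁻¹' Set.Iic (u n)))) :=
    (ENNReal.tendsto_toReal (measure_ne_top _ _)).comp (tendsto_measure_iUnion_atTop
      fun i j hij => Set.preimage_mono (Set.Iic_subset_Iic.2 (hu.monotone hij)))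
  exact le_of_tendsto' ht fun n => h _ (hus n)

/-- **Glivenko–Cantelli theorem**. -/
theorem ae_tendsto_supDist_empCDF {Y : ℕ → Ω → ℝ} (hY : ∀ j, Measurable (Y j))
    (hindep : Pairwise fun i j => IndepFun (Y i) (Y j) Q)
    (hident : ∀ j, IdentDistrib (Y j) (Y 0) Q Q) (F : CDF)
    (hF : ∀ t, F t = Q.real (Y 0 ⁻¹' Set.Iic t)) :
    ∀ᵐ ω ∂Q, Tendsto (fun N : ℕ+ => supDist (empCDF (N := N) (fun j => Y j ω)) F)
      atTop (𝓝 0) := by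
  have hq : ∀ m k : ℕ, ∃ s, 0 < k → k < m → ∀ t, (k : ℝ) / m ≤ F t ↔ s ≤ t := by
    intro m k
    by_cases h : 0 < k ∧ k < m
    · have hm : (0 : ℝ) < m := by exact_mod_cast h.1.trans h.2
      obtain ⟨s, hs⟩ := F.exists_quantile (c := (k : ℝ) / m)
        (div_pos (by exact_mod_cast h.1) hm) ((div_lt_one hm).2 (by exact_mod_cast h.2))
      exact ⟨s, fun _ _ => hs⟩
    · exact ⟨0, fun h0 h1 => absurd ⟨h0, h1⟩ h⟩
  choose s hs using hq
  have h1 : ∀ᵐ ω ∂Q, ∀ m k, Tendsto (proportion (fun j => Y j ω) (Set.Iic (s m k))) atTop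
      (𝓝 (F (s m k))) := by
    refine ae_all_iff.2 fun m => ae_all_iff.2 fun k => ?_
    rw [hF]
    exact ae_tendsto_proportion hY hindep hident measurableSet_Iic
  have h2 : ∀ᵐ ω ∂Q, ∀ m k, Tendsto (proportion (fun j => Y j ω) (Set.Iio (s m k))) atTop
      (𝓝 (Q.real (Y 0 ⁻¹' Set.Iio (s m k)))) := by
    refine ae_all_iff.2 fun m => ae_all_iff.2 fun k => ?_
    exact ae_tendsto_proportion hY hindep hident measurableSet_Iio
  filter_upwards [h1, h2] with ω hω1 hω2
  refine tendsto_supDist_empCDF (fun j => Y j ω) F s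
    (fun m k => Q.real (Y 0 ⁻¹' Set.Iio (s m k))) hs hω1 hω2 fun m k hk hkm => ?_
  refine measureReal_lt_le_of_forall fun t ht => ?_
  rw [← hF]
  by_contra! h
  exact absurd ((hs m k hk hkm t).1 h.le) (not_le.2 ht)

/-- Independent pairs with independent components can be regrouped. -/
theorem IndepFun.prodMk_comm {α β γ δ : Type*} [MeasurableSpace α] [MeasurableSpace β]
    [MeasurableSpace γ] [MeasurableSpace δ] {A : Ω → α} {B : Ω → β} {C : Ω → γ} {D : Ω → δ}
    (hA : Measurable A) (hB : Measurable B) (hC : Measurable C) (hD : Measurable D)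
    (hAB : IndepFun A B Q) (hCD : IndepFun C D Q)
    (h : IndepFun (fun ω => (A ω, B ω)) (fun ω => (C ω, D ω)) Q) :
    IndepFun (fun ω => (A ω, C ω)) (fun ω => (B ω, D ω)) Q := by
  have hAC : IndepFun A C Q := h.comp measurable_fst measurable_fst
  have hBD : IndepFun B D Q := h.comp measurable_snd measurable_snd
  have := Measure.isProbabilityMeasure_map (μ := Q) hA.aemeasurable
  have := Measure.isProbabilityMeasure_map (μ := Q) hB.aemeasurable
  have := Measure.isProbabilityMeasure_map (μ := Q) hC.aemeasurable
  have := Measure.isProbabilityMeasure_map (μ := Q) hD.aemeasurable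
  rw [indepFun_iff_map_prod_eq_prod_map_map (by fun_prop) (by fun_prop)] at hAB hCD hAC hBD h ⊢
  rw [hAC, hBD]
  rw [hAB, hCD] at h
  set a := Q.map A
  set b := Q.map B
  set c := Q.map C
  set e := Q.map D
  -- Reassociating and swapping the two middle factors carries one product of the four laws to the
  -- other.
  have hmid : MeasurePreserving (fun p : β × (γ × δ) => (p.2.1, (p.1, p.2.2)))
      (b.prod (c.prod e)) (c.prod (b.prod e)) :=
    (measurePreserving_prodAssoc c b e).comp
      (((Measure.measurePreserving_swap (μ := b) (ν := c)).prod (MeasurePreserving.id e)).comp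
        (measurePreserving_prodAssoc b c e).symm)
  have hall : MeasurePreserving (fun p : (α × β) × (γ × δ) => ((p.1.1, p.2.1), (p.1.2, p.2.2)))
      ((a.prod b).prod (c.prod e)) ((a.prod c).prod (b.prod e)) :=
    ((measurePreserving_prodAssoc a c (b.prod e)).symm).comp
      (((MeasurePreserving.id a).prod hmid).comp (measurePreserving_prodAssoc a b (c.prod e)))
  rw [← hall.map_eq, ← h, Measure.map_map hall.measurable (by fun_prop)]
  rfl

end Empirical

end SlicedCDF

namespace SlicedCDF

/-! ### Limits in distribution: constant shifts and perturbed i.i.d. sums -/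

section Limit

variable {Ω : Type*} [MeasurableSpace Ω] {Q : Measure Ω} [IsProbabilityMeasure Q]

/-- Two sequences of random variables that differ by constants and converge in distribution to the
same Gaussian law differ asymptotically by `0`. -/
theorem tendsto_zero_of_tendstoInDistribution_add_const {A : ℕ → Ω → ℝ} {b : ℕ → ℝ}
    {v : NNReal}
    (hA : TendstoInDistribution A atTop (id : ℝ → ℝ) (fun _ => Q) (gaussianReal 0 v))
    (hAb : TendstoInDistribution (fun H ω => A H ω + b H) atTop (id : ℝ → ℝ) (fun _ => Q)
      (gaussianReal 0 v)) :
    Tendsto b atTop (𝓝 0) := by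
  have key : Tendsto (fun H => diracProba (b H)) atTop (𝓝 (diracProba (0 : ℝ))) := by
    refine ProbabilityMeasure.tendsto_iff_tendsto_charFun.2 fun t => ?_
    have h1 := ProbabilityMeasure.tendsto_iff_tendsto_charFun.1 hA.tendsto t
    have h2 := ProbabilityMeasure.tendsto_iff_tendsto_charFun.1 hAb.tendsto t
    -- Nonvanishing, also for `v = 0`, permits division: the quotient of the two characteristic
    -- functions is that of the point mass at `b H`, and it tends to `1`.
    have hne : charFun ((gaussianReal 0 v).map (id : ℝ → ℝ)) t ≠ 0 := by
      rw [Measure.map_id, charFun_gaussianReal]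
      exact Complex.exp_ne_zero _
    have h3 := h2.div h1 hne
    have h0 : charFun (Measure.dirac (0 : ℝ)) t = 1 := by simp
    change Tendsto (fun H => charFun (Measure.dirac (b H)) t) atTop
      (𝓝 (charFun (Measure.dirac (0 : ℝ)) t))
    rw [h0]
    rw [ProbabilityMeasure.coe_mk, div_self hne] at h3
    refine h3.congr' ?_
    filter_upwards [h1.eventually_ne hne] with H hH
    have hmap : Q.map (fun ω => A H ω + b H) = (Q.map (A H)).map (· + b H) := by
      rw [AEMeasurable.map_map_of_aemeasurable (by fun_prop) (hA.forall_aemeasurable H)]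
      rfl
    rw [ProbabilityMeasure.coe_mk] at hH
    rw [Pi.div_apply, ProbabilityMeasure.coe_mk, ProbabilityMeasure.coe_mk, hmap,
      charFun_map_add_const, mul_div_cancel_left₀ _ hH, charFun_dirac]
  exact (isEmbedding_diracProba (X := ℝ)).tendsto_nhds_iff.2 key

/-- Shifting by constants that tend to `0` does not change the limit in distribution. -/
theorem tendstoInDistribution_add_const {A : ℕ → Ω → ℝ} {b : ℕ → ℝ} {v : NNReal}
    (hA : TendstoInDistribution A atTop (id : ℝ → ℝ) (fun _ => Q) (gaussianReal 0 v))
    (hb : Tendsto b atTop (𝓝 0)) :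
    TendstoInDistribution (fun H ω => A H ω + b H) atTop (id : ℝ → ℝ) (fun _ => Q)
      (gaussianReal 0 v) := by
  have h := hA.add_of_tendstoInMeasure_const (Y := fun H _ => b H) (c := 0)
    (tendstoInMeasure_of_tendsto_ae (fun _ => aestronglyMeasurable_const)
      (ae_of_all _ fun _ => hb)) (fun _ => aemeasurable_const)
  simp only [add_zero] at h
  exact h

/-- Pairwise independence makes the variance of the scaled sum equal to that of one term, which its
second moment bounds; Chebyshev concludes. -/
theorem tendstoInMeasure_scaled_sum_sub_integral {W : ℕ → ℕ → Ω → ℝ}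
    (hW : ∀ H i, MemLp (W H i) 2 Q)
    (hindep : ∀ H, Pairwise fun i j => IndepFun (W H i) (W H j) Q)
    (hident : ∀ H i, IdentDistrib (W H i) (W H 0) Q Q)
    (hlim : Tendsto (fun H => ∫ ω, W H 0 ω ^ 2 ∂Q) atTop (𝓝 0)) :
    TendstoInMeasure Q (fun (H : ℕ) ω => (√(H : ℝ))⁻¹ *
      (∑ i ∈ Finset.range H, W H i ω - H * ∫ ω', W H 0 ω' ∂Q)) atTop 0 := by
  rw [tendstoInMeasure_iff_norm]
  intro ε hε
  have hup : Tendsto (fun H => ENNReal.ofReal ((∫ ω, W H 0 ω ^ 2 ∂Q) / ε ^ 2)) atTop (𝓝 0) := by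
    have := ENNReal.tendsto_ofReal (hlim.div_const (ε ^ 2))
    simpa using this
  refine tendsto_of_tendsto_of_tendsto_of_le_of_le' tendsto_const_nhds hup
    (Eventually.of_forall fun _ => zero_le) ?_
  filter_upwards [eventually_gt_atTop 0] with H hH
  have hsum : MemLp (∑ i ∈ Finset.range H, W H i) 2 Q := memLp_finsetSum' _ fun i _ => hW H i
  have hS : MemLp (fun ω => (√(H : ℝ))⁻¹ * (∑ i ∈ Finset.range H, W H i) ω) 2 Q :=
    hsum.const_mul _
  have hmean : ∫ ω, (√(H : ℝ))⁻¹ * (∑ i ∈ Finset.range H, W H i) ω ∂Q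
      = (√(H : ℝ))⁻¹ * (H * ∫ ω', W H 0 ω' ∂Q) := by
    rw [integral_const_mul]
    congr 1
    simp only [Finset.sum_apply]
    rw [integral_finsetSum _ fun i _ => (hW H i).integrable one_le_two,
      Finset.sum_congr rfl fun i _ => (hident H i).integral_eq]
    simp
  have hvar : Var[fun ω => (√(H : ℝ))⁻¹ * (∑ i ∈ Finset.range H, W H i) ω; Q]
      ≤ ∫ ω, W H 0 ω ^ 2 ∂Q := by
    rw [variance_const_mul, IndepFun.variance_sum (fun i _ => hW H i)
      ((hindep H).set_pairwise _), Finset.sum_congr rfl fun i _ => (hident H i).variance_eq,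
      Finset.sum_const, Finset.card_range, nsmul_eq_mul, inv_pow,
      Real.sq_sqrt (Nat.cast_nonneg H), inv_mul_cancel_left₀ (by exact_mod_cast hH.ne')]
    exact variance_le_expectation_sq (hW H 0).aestronglyMeasurable
  refine le_trans (measure_mono fun ω hω => ?_)
    ((meas_ge_le_variance_div_sq hS hε).trans (ENNReal.ofReal_le_ofReal (by gcongr)))
  simp only [Set.mem_ofPred_eq, Pi.zero_apply, sub_zero, Real.norm_eq_abs] at hω
  rwa [Set.mem_ofPred_eq, hmean, ← mul_sub, Finset.sum_apply]

/-- A central limit theorem for the row means of an array whose rows approximate, in mean square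
and uniformly along the row, a fixed i.i.d. sequence. -/
theorem tendstoInDistribution_of_approx {D : ℕ → Ω → ℝ} {Z : ℕ → ℕ → Ω → ℝ} {v : NNReal}
    (hD : MemLp (D 0) 2 Q) (hDindep : iIndepFun D Q)
    (hDident : ∀ i, IdentDistrib (D i) (D 0) Q Q) (hv : Var[D 0; Q].toNNReal = v)
    (hZ : ∀ H i, MemLp (Z H i) 2 Q)
    (hindep : ∀ H, Pairwise fun i j =>
      IndepFun (fun ω => Z H i ω - D i ω) (fun ω => Z H j ω - D j ω) Q)
    (hident : ∀ H i,
      IdentDistrib (fun ω => Z H i ω - D i ω) (fun ω => Z H 0 ω - D 0 ω) Q Q)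
    (hlim : Tendsto (fun H => ∫ ω, (Z H 0 ω - D 0 ω) ^ 2 ∂Q) atTop (𝓝 0)) :
    TendstoInDistribution (fun (H : ℕ) ω => √(H : ℝ) * ((1 / (H : ℝ)) *
        ∑ i ∈ Finset.range H, Z H i ω - ∫ ω', Z H 0 ω' ∂Q))
      atTop (id : ℝ → ℝ) (fun _ => Q) (gaussianReal 0 v) := by
  subst hv
  have hclt := tendstoInDistribution_inv_sqrt_mul_sum_sub (P := Q) (X := D)
    (Y := (id : ℝ → ℝ)) HasLaw.id hD hDindep hDident
  have hDm : ∀ i, MemLp (D i) 2 Q := fun i => (hDident i).memLp_iff.2 hD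
  have herr := tendstoInMeasure_scaled_sum_sub_integral (W := fun H i ω => Z H i ω - D i ω)
    (fun H i => (hZ H i).sub (hDm i)) hindep hident hlim
  -- Slutsky: the difference from the normalised sum of the `D i` is exactly the centred, scaled sum
  -- of the errors `Z H i - D i`.
  refine tendstoInDistribution_of_tendstoInMeasure_sub _ _ hclt ?_ fun H => ?_
  · convert herr using 1
    funext H ω
    rcases Nat.eq_zero_or_pos H with rfl | hH
    · simp
    have hH' : (0 : ℝ) < H := by exact_mod_cast hH
    have hint := integral_sub ((hZ H 0).integrable one_le_two) ((hDm 0).integrable one_le_two)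
    have hsq : √(H : ℝ) * (1 / (H : ℝ)) = (√(H : ℝ))⁻¹ := by
      rw [mul_one_div, Real.sqrt_div_self]
    have hsq' : √(H : ℝ) = (√(H : ℝ))⁻¹ * H := by
      rw [inv_mul_eq_div, Real.div_sqrt]
    simp only [Pi.sub_apply, Finset.sum_sub_distrib]
    rw [hint, mul_sub, ← mul_assoc, hsq]
    nth_rewrite 2 [hsq']
    ring
  · have := Finset.aemeasurable_fun_sum (Finset.range H) fun i _ =>
      (hZ H i).aestronglyMeasurable.aemeasurable
    fun_prop

end Limit

/-- Convergence to `0` almost everywhere on almost every section implies convergence to `0` almost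
everywhere on the product. -/
theorem ae_prod_tendsto_of_ae_ae {α β ι : Type*} [MeasurableSpace α] [MeasurableSpace β]
    {μ : Measure α} {ν : Measure β} [SFinite μ] [SFinite ν] [Countable ι] {l : Filter ι}
    [l.IsCountablyGenerated] {g : ι → α × β → ℝ} (hg : ∀ i, AEMeasurable (g i) (μ.prod ν))
    (h : ∀ᵐ u ∂μ, ∀ᵐ ω ∂ν, Tendsto (fun i => g i (u, ω)) l (𝓝 0)) :
    ∀ᵐ z ∂μ.prod ν, Tendsto (fun i => g i z) l (𝓝 0) := by
  -- Fubini for null sets needs a measurable convergence set, hence the passage to measurable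
  -- versions.
  have heq : ∀ᵐ z ∂μ.prod ν, ∀ i, g i z = (hg i).mk _ z :=
    ae_all_iff.2 fun i => (hg i).ae_eq_mk
  have hset : MeasurableSet {z | Tendsto (fun i => (hg i).mk _ z) l (𝓝 0)} :=
    measurableSet_tendsto _ fun i => (hg i).measurable_mk
  have hmk : ∀ᵐ z ∂μ.prod ν, Tendsto (fun i => (hg i).mk _ z) l (𝓝 0) := by
    rw [Measure.ae_prod_iff_ae_ae hset]
    filter_upwards [h, Measure.ae_ae_of_ae_prod heq] with u hu hu'
    filter_upwards [hu, hu'] with ω hω hω'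
    simpa only [hω'] using hω
  filter_upwards [heq, hmk] with z hz hz'
  simpa only [hz] using hz'

end SlicedCDF

/-! ### Empirical distances along a fixed direction -/

namespace SlicedCDF

theorem SupContinuousFst.tendsto {d : CDF → CDF → ℝ} (hcont : SupContinuousFst d) {ι : Type*}
    {l : Filter ι} {f : ι → CDF} {f₀ : CDF} (h : Tendsto (fun i => supDist (f i) f₀) l (𝓝 0))
    (g : CDF) : Tendsto (fun i => d (f i) g) l (𝓝 (d f₀ g)) := by
  rw [Metric.tendsto_nhds]
  intro ε hε
  obtain ⟨δ, hδ, hδε⟩ := hcont g f₀ ε hε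
  filter_upwards [h.eventually (gt_mem_nhds hδ)] with i hi
  exact hδε _ hi

section Projection

variable {n : ℕ} {ΩX ΩY Ω : Type*} [MeasurableSpace ΩX] [MeasurableSpace ΩY] [MeasurableSpace Ω]
  {PX : Measure ΩX} {PY : Measure ΩY} {Q : Measure Ω} [IsProbabilityMeasure PX]
  [IsProbabilityMeasure Q] {X : ΩX → E n} {Y : ΩY → E n} {d : CDF → CDF → ℝ}

theorem ae_tendsto_empDist (hX : Measurable X) (hcont : SupContinuousFst d)
    {ξ : ℕ → Ω → E n} (hξ : ∀ j, Measurable (ξ j))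
    (hξ_law : ∀ j, IdentDistrib (ξ j) X Q PX) (hξ_indep : iIndepFun ξ Q) (u : Sph n) :
    ∀ᵐ ω ∂Q, Tendsto (fun N : ℕ+ => empDist d PY Y u (fun j : Fin N => ξ j ω)) atTop
      (𝓝 (d (projCDF PX X u) (projCDF PY Y u))) := by
  have hm : Measurable (fun x : E n => ⟪(u : E n), x⟫) := by fun_prop
  have hgc := ae_tendsto_supDist_empCDF (Q := Q) (Y := fun j ω => ⟪(u : E n), ξ j ω⟫)
    (fun j => hm.comp (hξ j)) (fun i j hij => (hξ_indep.indepFun hij).comp hm hm)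
    (fun j => ((hξ_law j).trans (hξ_law 0).symm).comp hm) (projCDF PX X u) fun t => by
      rw [projCDF_apply PX X hX]
      have := ((hξ_law 0).comp hm).measure_mem_eq (measurableSet_Iic (a := t))
      exact congrArg ENNReal.toReal this.symm
  filter_upwards [hgc] with ω hω
  exact hcont.tendsto hω _

end Projection

theorem iIndepFun.row {Ω α : Type*} [MeasurableSpace Ω] [MeasurableSpace α] {Q : Measure Ω}
    {ξ : ℕ → ℕ → Ω → α}
    (h : iIndepFun (fun p : ℕ × ℕ => ξ p.1 p.2) Q) (i : ℕ) : iIndepFun (ξ i) Q :=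
  h.precomp (g := fun j => (i, j)) (Prod.mk_right_injective i)

/-! ### Law and independence of the rows -/

section Rows

variable {n : ℕ} {ΩX Ωq Ω : Type*} [MeasurableSpace ΩX] [MeasurableSpace Ωq] [MeasurableSpace Ω]
  {PX : Measure ΩX} {Pq : Measure Ωq} {Q : Measure Ω} [IsProbabilityMeasure Q]
  {X : ΩX → E n} {q : Ωq → Sph n} {qs : ℕ → Ω → Sph n} {Xs : ℕ → ℕ → Ω → E n}

theorem measurePreserving_sample {ξ : ℕ → Ω → E n}
    (hξ : ∀ j, Measurable (ξ j)) (hξ_law : ∀ j, IdentDistrib (ξ j) X Q PX)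
    (hξ_indep : iIndepFun ξ Q) (N : ℕ) :
    MeasurePreserving (fun ω (j : Fin N) => ξ j ω) Q (Measure.pi fun _ => PX.map X) := by
  refine ⟨by fun_prop, ?_⟩
  have h := (hξ_indep.precomp (g := fun j : Fin N => (j : ℕ)) Fin.val_injective)
  rw [iIndepFun_iff_map_fun_eq_pi_map fun j => (hξ _).aemeasurable] at h
  rw [h]
  congr 1
  funext j
  exact (hξ_law j).map_eq

theorem measurePreserving_row (hqs : ∀ i, Measurable (qs i)) (hXs : ∀ i j, Measurable (Xs i j))
    (hqs_law : ∀ i, IdentDistrib (qs i) q Q Pq)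
    (hXs_law : ∀ i j, IdentDistrib (Xs i j) X Q PX)
    (hXs_indep : iIndepFun (fun p : ℕ × ℕ => Xs p.1 p.2) Q)
    (hindep : IndepFun (fun ω i => qs i ω) (fun ω (p : ℕ × ℕ) => Xs p.1 p.2 ω) Q)
    (N i : ℕ) :
    MeasurePreserving (fun ω => (qs i ω, fun j : Fin N => Xs i j ω)) Q
      ((Pq.map q).prod (Measure.pi fun _ => PX.map X)) := by
  refine ⟨by fun_prop, ?_⟩
  have hi : IndepFun (qs i) (fun ω (j : Fin N) => Xs i j ω) Q := by
    have hφ : Measurable fun f : ℕ → Sph n => f i := by fun_prop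
    have hψ : Measurable fun (f : ℕ × ℕ → E n) (j : Fin N) => f (i, (j : ℕ)) := by fun_prop
    exact hindep.comp hφ hψ
  rw [hi.map_prod_eq_prod_map_map (by fun_prop) (by fun_prop), (hqs_law i).map_eq,
    (measurePreserving_sample (hXs i) (hXs_law i) (iIndepFun.row hXs_indep i) N).map_eq]

/-- The two sample blocks use disjoint index sets, the two directions are independent, and
directions are independent of samples; regrouping the four pieces gives the claim. -/
theorem indepFun_row (hqs : ∀ i, Measurable (qs i)) (hXs : ∀ i j, Measurable (Xs i j))
    (hqs_indep : iIndepFun qs Q)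
    (hXs_indep : iIndepFun (fun p : ℕ × ℕ => Xs p.1 p.2) Q)
    (hindep : IndepFun (fun ω i => qs i ω) (fun ω (p : ℕ × ℕ) => Xs p.1 p.2 ω) Q)
    (N : ℕ) {i k : ℕ} (hik : i ≠ k) :
    IndepFun (fun ω => (qs i ω, fun j : Fin N => Xs i j ω))
      (fun ω => (qs k ω, fun j : Fin N => Xs k j ω)) Q := by
  classical
  have hrows : IndepFun (fun ω (j : Fin N) => Xs i j ω) (fun ω (j : Fin N) => Xs k j ω) Q := by
    have hS (a : ℕ) (j : Fin N) : (a, (j : ℕ)) ∈ ({a} : Finset ℕ) ×ˢ Finset.range N := by simp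
    have hdisj : Disjoint (({i} : Finset ℕ) ×ˢ Finset.range N)
        (({k} : Finset ℕ) ×ˢ Finset.range N) :=
      Finset.disjoint_product.2 (Or.inl (by simpa using hik))
    exact (hXs_indep.indepFun_finset _ _ hdisj fun p => hXs p.1 p.2).comp
      (φ := fun f (j : Fin N) => f ⟨(i, j), hS i j⟩)
      (ψ := fun f (j : Fin N) => f ⟨(k, j), hS k j⟩) (by fun_prop) (by fun_prop)
  refine IndepFun.prodMk_comm (hqs i) (hqs k) (by fun_prop) (by fun_prop)
    (hqs_indep.indepFun hik) hrows ?_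
  exact hindep.comp (φ := fun f => (f i, f k))
    (ψ := fun f => ((fun j : Fin N => f (i, (j : ℕ))), fun j : Fin N => f (k, (j : ℕ))))
    (by fun_prop) (by fun_prop)

end Rows

/-! ### Vanishing moments of the error -/

section Approximation

variable {n : ℕ} {ΩX ΩY Ωq Ω : Type*} [MeasurableSpace ΩX] [MeasurableSpace ΩY]
  [MeasurableSpace Ωq] [MeasurableSpace Ω]
  {PX : Measure ΩX} {PY : Measure ΩY} {Pq : Measure Ωq} {Q : Measure Ω}
  {X : ΩX → E n} {Y : ΩY → E n} {q : Ωq → Sph n} {d : CDF → CDF → ℝ}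

/-- The error made by replacing the law of `X` with the empirical law of a sample, as a function
of the direction and the sample. -/
noncomputable def empError (d : CDF → CDF → ℝ) (PX : Measure ΩX) (PY : Measure ΩY)
    (X : ΩX → E n) (Y : ΩY → E n) {N : ℕ+} (p : Sph n × (Fin N → E n)) : ℝ :=
  empDist d PY Y p.1 p.2 - d (projCDF PX X p.1) (projCDF PY Y p.1)

theorem abs_empError_le (hd : IsDistance d) {M : ℝ} (hM : ∀ f g, d f g ≤ M) {N : ℕ+}
    (p : Sph n × (Fin N → E n)) : |empError d PX PY X Y p| ≤ M :=
  abs_sub_le_of_nonneg_of_le (hd.nonneg _ _) (hM _ _) (hd.nonneg _ _) (hM _ _)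

theorem aemeasurable_empError [IsProbabilityMeasure PX] [IsProbabilityMeasure Pq]
    (hX : Measurable X) (hq : Measurable q)
    (hmeas : AEMeasurable (fun u : Sph n => d (projCDF PX X u) (projCDF PY Y u)) (Pq.map q))
    (hmeasN : ∀ N : ℕ+, AEMeasurable
      (fun p : Sph n × (Fin N → E n) => empDist d PY Y p.1 p.2)
      ((Pq.map q).prod (Measure.pi fun _ => PX.map X))) (N : ℕ+) :
    AEMeasurable (empError d PX PY X Y (N := N))
      ((Pq.map q).prod (Measure.pi fun _ => PX.map X)) := by
  have := Measure.isProbabilityMeasure_map (μ := PX) hX.aemeasurable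
  have := Measure.isProbabilityMeasure_map (μ := Pq) hq.aemeasurable
  exact (hmeasN N).sub (hmeas.comp_quasiMeasurePreserving Measure.quasiMeasurePreserving_fst)

/-- The error tends to `0` in the mean, together with all its powers. -/
theorem tendsto_integral_empError_pow [IsProbabilityMeasure PX] [IsProbabilityMeasure Pq]
    [IsProbabilityMeasure Q] (hX : Measurable X) (hq : Measurable q)
    (hd : IsDistance d) (hcont : SupContinuousFst d) {M : ℝ} (hM : ∀ f g, d f g ≤ M)
    (hmeas : AEMeasurable (fun u : Sph n => d (projCDF PX X u) (projCDF PY Y u)) (Pq.map q))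
    (hmeasN : ∀ N : ℕ+, AEMeasurable
      (fun p : Sph n × (Fin N → E n) => empDist d PY Y p.1 p.2)
      ((Pq.map q).prod (Measure.pi fun _ => PX.map X)))
    {ξ : ℕ → Ω → E n} (hξ : ∀ j, Measurable (ξ j))
    (hξ_law : ∀ j, IdentDistrib (ξ j) X Q PX) (hξ_indep : iIndepFun ξ Q)
    {k : ℕ} (hk : k ≠ 0) :
    Tendsto (fun N : ℕ+ => ∫ p, empError d PX PY X Y (N := N) p ^ k
      ∂((Pq.map q).prod (Measure.pi fun _ => PX.map X))) atTop (𝓝 0) := by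
  have := Measure.isProbabilityMeasure_map (μ := PX) hX.aemeasurable
  have := Measure.isProbabilityMeasure_map (μ := Pq) hq.aemeasurable
  have hG := aemeasurable_empError hX hq hmeas hmeasN
  -- For different `N` the integrals live on different spaces. One infinite sample `ξ` realises them
  -- all on `Sph n × Ω`, where almost sure convergence makes sense.
  have hS : ∀ N : ℕ+, MeasurePreserving
      (fun p : Sph n × Ω => (p.1, fun j : Fin N => ξ j p.2)) ((Pq.map q).prod Q)
      ((Pq.map q).prod (Measure.pi fun _ => PX.map X)) := fun N =>
    (MeasurePreserving.id _).prod (measurePreserving_sample hξ hξ_law hξ_indep N)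
  have hGS : ∀ N : ℕ+, AEMeasurable
      (fun p : Sph n × Ω => empError d PX PY X Y (N := N) (p.1, fun j : Fin N => ξ j p.2))
      ((Pq.map q).prod Q) := fun N =>
    (hG N).comp_quasiMeasurePreserving (hS N).quasiMeasurePreserving
  have heq : ∀ N : ℕ+, ∫ p, empError d PX PY X Y (N := N) p ^ k
      ∂((Pq.map q).prod (Measure.pi fun _ => PX.map X))
      = ∫ p : Sph n × Ω, empError d PX PY X Y (N := N) (p.1, fun j : Fin N => ξ j p.2) ^ k
        ∂((Pq.map q).prod Q) := by
    intro N
    rw [← (hS N).map_eq, integral_map (hS N).measurable.aemeasurable]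
    rw [(hS N).map_eq]
    exact ((hG N).pow_const k).aestronglyMeasurable
  have hae : ∀ᵐ p ∂((Pq.map q).prod Q), Tendsto (fun N : ℕ+ =>
      empError d PX PY X Y (N := N) (p.1, fun j : Fin N => ξ j p.2)) atTop (𝓝 0) := by
    refine ae_prod_tendsto_of_ae_ae hGS (ae_of_all _ fun u => ?_)
    filter_upwards [ae_tendsto_empDist (PY := PY) (Y := Y) hX hcont hξ hξ_law hξ_indep u]
      with ω hω
    exact tendsto_sub_nhds_zero_iff.2 hω
  simp_rw [heq]
  have hdct := tendsto_integral_filter_of_dominated_convergence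
    (F := fun (N : ℕ+) (p : Sph n × Ω) =>
      empError d PX PY X Y (N := N) (p.1, fun j : Fin N => ξ j p.2) ^ k)
    (f := fun _ => 0) (l := atTop) (fun _ => M ^ k)
    (Eventually.of_forall fun N => ((hGS N).pow_const k).aestronglyMeasurable)
    (Eventually.of_forall fun N => ae_of_all _ fun p => by
      rw [norm_pow, Real.norm_eq_abs]
      exact pow_le_pow_left₀ (abs_nonneg _) (abs_empError_le hd hM _) k)
    (integrable_const _) (hae.mono fun p hp => by simpa [hk] using hp.pow k)
  simpa using hdct

end Approximation

end SlicedCDF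

/-! ### Assembly of the theorem -/

theorem mainTheorem4 {n : ℕ} {ΩX ΩY Ωq Ω : Type*}
    [MeasurableSpace ΩX] [MeasurableSpace ΩY] [MeasurableSpace Ωq] [MeasurableSpace Ω]
    (PX : Measure ΩX) (PY : Measure ΩY) (Pq : Measure Ωq) (Q : Measure Ω)
    [IsProbabilityMeasure PX] [IsProbabilityMeasure PY] [IsProbabilityMeasure Pq]
    [IsProbabilityMeasure Q]
    -- the random vectors and the random direction
    (X : ΩX → SlicedCDF.E n) (Y : ΩY → SlicedCDF.E n) (q : Ωq → SlicedCDF.Sph n)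
    (hX : Measurable X) (hY : Measurable Y) (hq : Measurable q)
    -- the distance on CDFs
    (d : SlicedCDF.CDF → SlicedCDF.CDF → ℝ) (hd : SlicedCDF.IsDistance d)
    (hcont : SlicedCDF.SupContinuousFst d) (M : ℝ) (hM : ∀ f g, d f g ≤ M)
    -- the quantities whose expectations and laws are considered are random variables
    (hmeas : AEMeasurable (fun u : SlicedCDF.Sph n =>
      d (SlicedCDF.projCDF PX X u) (SlicedCDF.projCDF PY Y u)) (Pq.map q))
    (hmeasN : ∀ N : ℕ+, AEMeasurable
      (fun p : SlicedCDF.Sph n × (Fin N → SlicedCDF.E n) => SlicedCDF.empDist d PY Y p.1 p.2)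
      ((Pq.map q).prod (Measure.pi fun _ => PX.map X)))
    -- the samples
    (qs : ℕ → Ω → SlicedCDF.Sph n) (Xs : ℕ → ℕ → Ω → SlicedCDF.E n)
    (hqs : ∀ i, Measurable (qs i)) (hXs : ∀ i j, Measurable (Xs i j))
    (hqs_law : ∀ i, IdentDistrib (qs i) q Q Pq)
    (hXs_law : ∀ i j, IdentDistrib (Xs i j) X Q PX)
    (hqs_indep : iIndepFun qs Q)
    (hXs_indep : iIndepFun (fun p : ℕ × ℕ => Xs p.1 p.2) Q)
    (hindep : IndepFun (fun ω i => qs i ω) (fun ω (p : ℕ × ℕ) => Xs p.1 p.2 ω) Q) :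
    -- asymptotic normality whenever `N_H → ∞`: around the mean of the estimator always, and
    -- around `Δ(X, Y)` if and only if the bias, scaled by `√H`, vanishes
    (∀ N : ℕ → ℕ+, Tendsto N atTop atTop →
      TendstoInDistribution
        (fun (H : ℕ) ω => √(H : ℝ) * (SlicedCDF.estimator d PY Y qs Xs H (N H) ω
          - ∫ ω', SlicedCDF.estimator d PY Y qs Xs H (N H) ω' ∂Q))
        atTop (id : ℝ → ℝ) (fun _ => Q)
        (gaussianReal 0 (SlicedCDF.slicedVar d PX PY Pq X Y q).toNNReal)
      ∧
      (TendstoInDistribution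
        (fun (H : ℕ) ω => √(H : ℝ) * (SlicedCDF.estimator d PY Y qs Xs H (N H) ω
          - SlicedCDF.slicedDist d PX PY Pq X Y q))
        atTop (id : ℝ → ℝ) (fun _ => Q)
        (gaussianReal 0 (SlicedCDF.slicedVar d PX PY Pq X Y q).toNNReal)
      ↔ Tendsto (fun H : ℕ => √(H : ℝ) * ((∫ ω, SlicedCDF.estimator d PY Y qs Xs H (N H) ω ∂Q)
          - SlicedCDF.slicedDist d PX PY Pq X Y q)) atTop (𝓝 0)))
    ∧
    -- asymptotic normality around `Δ(X, Y)` whenever `N_H` grows fast enough with `H`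
    (∃ N₀ : ℕ → ℕ+, ∀ N : ℕ → ℕ+, (∀ᶠ H in atTop, N₀ H ≤ N H) →
      TendstoInDistribution
        (fun (H : ℕ) ω => √(H : ℝ) * (SlicedCDF.estimator d PY Y qs Xs H (N H) ω
          - SlicedCDF.slicedDist d PX PY Pq X Y q))
        atTop (id : ℝ → ℝ) (fun _ => Q)
        (gaussianReal 0 (SlicedCDF.slicedVar d PX PY Pq X Y q).toNNReal)) := by
  have := Measure.isProbabilityMeasure_map (μ := PX) hX.aemeasurable
  have := Measure.isProbabilityMeasure_map (μ := Pq) hq.aemeasurable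
  set Δ := SlicedCDF.slicedDist d PX PY Pq X Y q
  set v := (SlicedCDF.slicedVar d PX PY Pq X Y q).toNNReal
  let D : SlicedCDF.Sph n → ℝ := fun u => d (SlicedCDF.projCDF PX X u) (SlicedCDF.projCDF PY Y u)
  let G : ∀ N : ℕ+, SlicedCDF.Sph n × (Fin N → SlicedCDF.E n) → ℝ := fun N =>
    SlicedCDF.empError d PX PY X Y
  let row : ∀ (N : ℕ+) (i : ℕ), Ω → SlicedCDF.Sph n × (Fin N → SlicedCDF.E n) :=
    fun N i ω => (qs i ω, fun j => Xs i j ω)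
  let Z : ℕ+ → ℕ → Ω → ℝ := fun N i ω =>
    SlicedCDF.empDist d PY Y (qs i ω) (fun j : Fin N => Xs i j ω)
  have hrow : ∀ N i, MeasurePreserving (row N i) Q
      ((Pq.map q).prod (Measure.pi fun _ => PX.map X)) := fun N i =>
    SlicedCDF.measurePreserving_row hqs hXs hqs_law hXs_law hXs_indep hindep N i
  have hG : ∀ N, AEMeasurable (G N) ((Pq.map q).prod (Measure.pi fun _ => PX.map X)) :=
    SlicedCDF.aemeasurable_empError hX hq hmeas hmeasN
  have hrow_ident : ∀ N i j, IdentDistrib (row N i) (row N j) Q Q := fun N i j =>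
    ⟨(hrow N i).aemeasurable, (hrow N j).aemeasurable,
      (hrow N i).map_eq.trans (hrow N j).map_eq.symm⟩
  have hbound : ∀ f g, ‖d f g‖ ≤ M := fun f g => by
    rw [Real.norm_eq_abs, abs_of_nonneg (hd.nonneg f g)]
    exact hM f g
  have hDq : ∀ i, IdentDistrib (D ∘ qs i) (D ∘ q) Q Pq := fun i =>
    (hqs_law i).comp_of_aemeasurable (by rw [(hqs_law i).map_eq]; exact hmeas)
  have hDident : ∀ i, IdentDistrib (D ∘ qs i) (D ∘ qs 0) Q Q := fun i =>
    (hDq i).trans (hDq 0).symm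
  have hDindep : iIndepFun (fun i => D ∘ qs i) Q :=
    hqs_indep.comp₀ _ (fun i => (hqs i).aemeasurable)
      fun i => by rw [(hqs_law i).map_eq]; exact hmeas
  have hDmem : ∀ i, MemLp (D ∘ qs i) 2 Q := fun i =>
    MemLp.of_bound (hDq i).aemeasurable_fst.aestronglyMeasurable M (ae_of_all _ fun _ => hbound _ _)
  have hZmem : ∀ N i, MemLp (Z N i) 2 Q := fun N i =>
    MemLp.of_bound ((hmeasN N).comp_quasiMeasurePreserving
      (hrow N i).quasiMeasurePreserving).aestronglyMeasurable M (ae_of_all _ fun _ => hbound _ _)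
  have hDmean : ∫ ω, (D ∘ qs 0) ω ∂Q = Δ := (hDq 0).integral_eq
  have hintG : ∀ (N : ℕ+) (k : ℕ), ∫ ω, G N (row N 0 ω) ^ k ∂Q
      = ∫ p, G N p ^ k ∂((Pq.map q).prod (Measure.pi fun _ => PX.map X)) := by
    intro N k
    rw [← (hrow N 0).map_eq, integral_map (hrow N 0).aemeasurable]
    rw [(hrow N 0).map_eq]
    exact ((hG N).pow_const k).aestronglyMeasurable
  -- Used for `k = 1` (bias) and `k = 2` (mean-square error).
  have hlim : ∀ k : ℕ, k ≠ 0 → Tendsto (fun N : ℕ+ => ∫ ω, G N (row N 0 ω) ^ k ∂Q)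
      atTop (𝓝 0) := by
    intro k hk
    simp_rw [hintG]
    exact SlicedCDF.tendsto_integral_empError_pow hX hq hd hcont hM hmeas hmeasN (hXs 0)
      (hXs_law 0) (SlicedCDF.iIndepFun.row hXs_indep 0) hk
  have hZmean : Tendsto (fun N : ℕ+ => ∫ ω, Z N 0 ω ∂Q - Δ) atTop (𝓝 0) := by
    refine (hlim 1 one_ne_zero).congr fun N => ?_
    rw [← hDmean, ← integral_sub ((hZmem N 0).integrable one_le_two)
      ((hDmem 0).integrable one_le_two)]
    simp_rw [pow_one]
    rfl
  have hmean : ∀ (H : ℕ) (N : ℕ+), 0 < H →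
      ∫ ω, SlicedCDF.estimator d PY Y qs Xs H N ω ∂Q = ∫ ω, Z N 0 ω ∂Q := by
    intro H N hH
    have hZint : ∀ i, ∫ ω, Z N i ω ∂Q = ∫ ω, Z N 0 ω ∂Q := fun i =>
      ((hrow_ident N i 0).comp_of_aemeasurable 
        (u := fun p : SlicedCDF.Sph n × (Fin N → SlicedCDF.E n) =>
          SlicedCDF.empDist d PY Y (N := N) p.1 p.2) (by rw [(hrow N i).map_eq]; exact hmeasN N)).integral_eq
    change ∫ ω, (1 / (H : ℝ)) * ∑ i ∈ Finset.range H, Z N i ω ∂Q = _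
    rw [integral_const_mul, integral_finsetSum _ fun i _ => (hZmem N i).integrable one_le_two,
      Finset.sum_congr rfl fun i _ => hZint i, Finset.sum_const, Finset.card_range, nsmul_eq_mul,
      one_div, inv_mul_cancel_left₀ (by exact_mod_cast hH.ne')]
  have hclt : ∀ N : ℕ → ℕ+, Tendsto N atTop atTop → TendstoInDistribution
      (fun (H : ℕ) ω => √(H : ℝ) * (SlicedCDF.estimator d PY Y qs Xs H (N H) ω
        - ∫ ω', SlicedCDF.estimator d PY Y qs Xs H (N H) ω' ∂Q))
      atTop (id : ℝ → ℝ) (fun _ => Q) (gaussianReal 0 v) := by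
    intro N hN
    have h := SlicedCDF.tendstoInDistribution_of_approx (D := fun i => D ∘ qs i)
      (Z := fun H => Z (N H)) (v := v) (hDmem 0) hDindep hDident
      (by rw [(hDq 0).variance_eq]; rfl) (fun H i => hZmem (N H) i)
      (fun H i j hij => (SlicedCDF.indepFun_row hqs hXs hqs_indep hXs_indep hindep (N H) hij).comp₀
        (φ := G (N H)) (ψ := G (N H)) (hrow (N H) i).aemeasurable (hrow (N H) j).aemeasurable
        (by rw [(hrow (N H) i).map_eq]; exact hG _) (by rw [(hrow (N H) j).map_eq]; exact hG _))
      (fun H i => (hrow_ident (N H) i 0).comp_of_aemeasurable (u := G (N H))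
        (by rw [(hrow (N H) i).map_eq]; exact hG _))
      ((hlim 2 two_ne_zero).comp hN)
    refine h.congr (fun H => ae_of_all _ fun ω => ?_) (ae_of_all _ fun _ => rfl)
    have hest : SlicedCDF.estimator d PY Y qs Xs H (N H) ω
        = 1 / (H : ℝ) * ∑ i ∈ Finset.range H, Z (N H) i ω := rfl
    -- The empty estimator has the wrong mean, but the factor `√0` removes it.
    rcases Nat.eq_zero_or_pos H with rfl | hH
    · simp only [Nat.cast_zero, Real.sqrt_zero, zero_mul]
    · beta_reduce
      rw [hest, hmean H (N H) hH]
  have hsplit : ∀ N : ℕ → ℕ+, (fun (H : ℕ) ω =>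
      √(H : ℝ) * (SlicedCDF.estimator d PY Y qs Xs H (N H) ω - Δ))
      = fun (H : ℕ) ω => √(H : ℝ) * (SlicedCDF.estimator d PY Y qs Xs H (N H) ω
          - ∫ ω', SlicedCDF.estimator d PY Y qs Xs H (N H) ω' ∂Q)
        + √(H : ℝ) * ((∫ ω', SlicedCDF.estimator d PY Y qs Xs H (N H) ω' ∂Q) - Δ) := by
    intro N
    funext H ω
    ring
  have hbias : ∀ N : ℕ → ℕ+, Tendsto N atTop atTop → (TendstoInDistribution
      (fun (H : ℕ) ω => √(H : ℝ) * (SlicedCDF.estimator d PY Y qs Xs H (N H) ω - Δ))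
      atTop (id : ℝ → ℝ) (fun _ => Q) (gaussianReal 0 v)
      ↔ Tendsto (fun H : ℕ => √(H : ℝ) * ((∫ ω, SlicedCDF.estimator d PY Y qs Xs H (N H) ω ∂Q)
          - Δ)) atTop (𝓝 0)) := by
    intro N hN
    rw [hsplit N]
    exact ⟨SlicedCDF.tendsto_zero_of_tendstoInDistribution_add_const (hclt N hN),
      SlicedCDF.tendstoInDistribution_add_const (hclt N hN)⟩
  refine ⟨fun N hN => ⟨hclt N hN, hbias N hN⟩, ?_⟩
  have hex : ∀ H : ℕ, ∃ N₁ : ℕ+, ∀ N ≥ N₁, |∫ ω, Z N 0 ω ∂Q - Δ| < 1 / ((H : ℝ) + 1) := by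
    intro H
    have := hZmean.eventually (Metric.ball_mem_nhds (0 : ℝ) (ε := 1 / ((H : ℝ) + 1))
      (by positivity))
    obtain ⟨N₁, hN₁⟩ := eventually_atTop.1 this
    exact ⟨N₁, fun N hN => by simpa using hN₁ N hN⟩
  choose N₁ hN₁ using hex
  -- `N₁ H` makes the bias smaller than `1 / (H + 1)`, so that the scaled bias is at most `1 / √H`;
  -- `H + 1` forces `N_H → ∞`.
  refine ⟨fun H => max (N₁ H) H.succPNat, fun N hN => ?_⟩
  have hNtop : Tendsto N atTop atTop := by
    refine tendsto_atTop.2 fun b => ?_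
    filter_upwards [hN, eventually_ge_atTop (b : ℕ)] with H hH hb
    refine le_trans ?_ ((le_max_right _ _).trans hH)
    rw [← PNat.coe_le_coe, Nat.succPNat_coe]
    omega
  refine (hbias N hNtop).2 ?_
  have hz : Tendsto (fun H : ℕ => (√(H : ℝ))⁻¹) atTop (𝓝 0) :=
    tendsto_inv_atTop_zero.comp (Real.tendsto_sqrt_atTop.comp tendsto_natCast_atTop_atTop)
  refine squeeze_zero_norm' ?_ hz
  filter_upwards [hN, eventually_gt_atTop 0] with H hH hpos
  have hHpos : (0 : ℝ) < H := by exact_mod_cast hpos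
  rw [hmean H (N H) hpos, norm_mul, Real.norm_of_nonneg (Real.sqrt_nonneg _), Real.norm_eq_abs]
  calc √(H : ℝ) * |∫ ω, Z (N H) 0 ω ∂Q - Δ|
      ≤ √(H : ℝ) * (1 / (H : ℝ)) := by
        gcongr
        refine (hN₁ H (N H) ((le_max_left _ _).trans hH)).le.trans ?_
        gcongr
        linarith
    _ = (√(H : ℝ))⁻¹ := by rw [mul_one_div, Real.sqrt_div_self]
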